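/- Let $G$ and $H$ be locally compact Hausdorff groups and let $\Pi\colon H\to G$ be a continuous homomorphism. Let $h_L$ denote a left Haar measure on $H$, let $L^\infty(G)$ be the von Neumann algebra of (classes modulo locally null sets of) essentially bounded measurable functions on $G$ with respect to Haar measure, with predual $L^1(G)$ and positive cone $L^\infty(G)_+$, and let $H$ act on $L^\infty(G)$ by right translation along $\Pi$: $(\alpha_h f)(g)=f(g\,\Pi(h))$ for $h\in H$, $g\in G$. An element $f\in L^\infty(G)_+$ is called integrable if $\int_H\alpha_h(f)\,dh_L(h)$ exists in $L^\infty(G)$, i.e. if there is $y\in L^\infty(G)_+$ such that $$\int_H\Bigl(\int_G f(g\,\Pi(h))\,\varphi(g)\,dg\Bigr)dh_L(h)=\int_G y(g)\,\varphi(g)\,dg\qquad\text{for all }0\le\varphi\in L^1(G),$$ and the action is called integrable if the integrable elements are dense in $L^\infty(G)_+$ in the $\sigma$-weak topology $\sigma(L^\infty(G),L^1(G))$. Then the action of $H$ on $L^\infty(G)$ is integrable if and only if 1. $\ker\Pi$ is compact, and 2. $\mathrm{im}\,\Pi$ is closed in $G$ and the canonical map $H/\ker\Pi\to\mathrm{im}\,\Pi$,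 $h\ker\Pi\mapsto\Pi(h)$, is a homeomorphism (for the quotient topology on $H/\ker\Pi$ and the subspace topology on $\mathrm{im}\,\Pi$). -/

import Mathlib

open MeasureTheory Measure
open scoped ENNReal ComplexOrder

noncomputable section

namespace IntegrableAction

section Space

variable {X : Type*} [MeasurableSpace X] (μ : Measure X)

/-- The commutative von Neumann algebra `L^∞(X, μ)` of classes of essentially bounded complex
functions. For a locally compact group `G` it is used with an inner regular (Radon) Haar measure;
for such a measure a measurable set is null as soon as all its compact subsets are null, so
classes modulo null sets are the same as classes modulo locally null sets. -/
abbrev LInf : Type _ := Lp ℂ ∞ μ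

/-- The predual `L^1(X, μ)` of `L^∞(X, μ)`. -/
abbrev LOne : Type _ := Lp ℂ 1 μ

variable {μ}

theorem ae_norm_le_norm_of_top (f : LInf μ) : ∀ᵐ g ∂μ, ‖f g‖ ≤ ‖f‖ := by
  filter_upwards [enorm_ae_le_eLpNormEssSup f μ] with g hg
  rw [Lp.norm_def, eLpNorm_exponent_top, ← toReal_enorm]
  exact ENNReal.toReal_mono (by simpa using (Lp.eLpNorm_lt_top f).ne) hg

/-- The duality pairing `⟨f, φ⟩ = ∫ f φ dμ`, i.e. the value at `f` of the normal functional
`ω_φ` on `L^∞(X, μ)` given by `φ ∈ L^1(X, μ)`. The integrand is always integrable. -/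
def pairing (f : LInf μ) (φ : LOne μ) : ℂ := ∫ x, f x * φ x ∂μ

variable (μ)

/-- The `σ`-weak topology on `L^∞(X, μ)`: the coarsest topology for which all the normal
functionals `f ↦ ⟨f, φ⟩`, `φ ∈ L^1(X, μ)`, are continuous. -/
@[reducible]
def sigmaWeak : TopologicalSpace (LInf μ) :=
  TopologicalSpace.induced (fun (f : LInf μ) (φ : LOne μ) => pairing f φ) inferInstance

/-- The cone of positive elements of `L^∞(X, μ)`: classes of functions with values in `[0, ∞)`. -/
def posCone : Set (LInf μ) := {f | ∀ᵐ x ∂μ, 0 ≤ f x}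

/-- The cone of positive normal functionals on `L^∞(X, μ)`, i.e. of nonnegative `φ` in `L^1`. -/
def posNormal : Set (LOne μ) := {φ | ∀ᵐ x ∂μ, 0 ≤ φ x}

end Space

section Action

variable {X H : Type*} [MeasurableSpace X] {μ : Measure X}
  [Group H] [MeasurableSpace H]

/-- Let `H` act on `N = L^∞(X, μ)` by `h ↦ α_h`, let `α : N → N ⊗ L^∞(H)` be the corresponding
map `α(f)(x, h) = (α_h f)(x)`, and let `φ ∈ L^1(X, μ)` give the normal functional `ω_φ` on `N`.
Then `(ω_φ ⊗ id) α(f)` is the function `h ↦ ω_φ(α_h f)` on `H`. -/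
def slice (α : Representation ℂ H (LInf μ)) (f : LInf μ) (φ : LOne μ) (h : H) : ℂ :=
  pairing (α h f) φ

/-- `f ∈ N_+` is integrable for the action `α` of `H` on `N = L^∞(X, μ)`, where `ν` is the left
Haar measure of `H` (with left Haar weight `h_L = ∫ · dν`): the element `(id ⊗ h_L) α(f)` of the
extended positive part of `N`, which is determined by
`ω ((id ⊗ h_L) α(f)) = h_L ((ω ⊗ id) α(f)) ∈ [0, ∞]` for positive normal `ω`,
is (given by) an element `y` of `N_+`. -/
def IsIntegrableElement (α : Representation ℂ H (LInf μ)) (ν : Measure H) (f : LInf μ) : Prop :=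
  f ∈ posCone μ ∧ ∃ y ∈ posCone μ, ∀ φ ∈ posNormal μ,
    ∫⁻ h, ENNReal.ofReal (slice α f φ h).re ∂ν = ENNReal.ofReal (pairing y φ).re

/-- The action `α` of `H` on `N = L^∞(X, μ)` is integrable: the integrable elements are
`σ`-weakly dense in `N_+`. -/
def IsIntegrableAction (α : Representation ℂ H (LInf μ)) (ν : Measure H) : Prop :=
  posCone μ ⊆ @closure (LInf μ) (sigmaWeak μ) {f | IsIntegrableElement α ν f}

end Action

section Translation

variable {G : Type*} [Group G] [TopologicalSpace G] [IsTopologicalGroup G]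
  [LocallyCompactSpace G] [MeasurableSpace G] [BorelSpace G]
  (μ : Measure G) [IsHaarMeasure μ] [InnerRegular μ]

theorem quasiMeasurePreserving_mul_right' (s : G) :
    QuasiMeasurePreserving (fun g : G => g * s) μ μ := by
  refine ⟨(continuous_mul_const s).measurable, ?_⟩
  rw [map_right_mul_eq_modularCharacterFun_smul μ s]
  exact smul_absolutelyContinuous

theorem memLp_translate (s : G) (f : LInf μ) : MemLp (fun g => f (g * s)) ∞ μ := by
  have hq := quasiMeasurePreserving_mul_right' μ s
  refine memLp_top_of_bound ((Lp.aestronglyMeasurable f).comp_quasiMeasurePreserving hq) ‖f‖ ?_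
  exact hq.ae (ae_norm_le_norm_of_top f)

/-- Right translation `f ↦ f(· s)` on `L^∞(G)`. -/
def translate (s : G) (f : LInf μ) : LInf μ := (memLp_translate μ s f).toLp _

theorem translate_ae (s : G) (f : LInf μ) : translate μ s f =ᵐ[μ] fun g => f (g * s) :=
  (memLp_translate μ s f).coeFn_toLp

variable {H : Type*} [Group H]

/-- The action of `H` on `L^∞(G)` by right translation along a homomorphism `Π : H → G`:
`(α_h f)(g) = f(g Π(h))`. -/
def translationAction (P : H →* G) : Representation ℂ H (LInf μ) where
  toFun h :=
    { toFun := fun f => translate μ (P h) f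
      map_add' := by
        intro f f'
        apply Lp.ext
        have h3 := (quasiMeasurePreserving_mul_right' μ (P h)).ae (Lp.coeFn_add f f')
        filter_upwards [translate_ae μ (P h) (f + f'), translate_ae μ (P h) f,
          translate_ae μ (P h) f', h3,
          Lp.coeFn_add (translate μ (P h) f) (translate μ (P h) f')] with g a b c d e
        rw [a, d, e, Pi.add_apply, Pi.add_apply, b, c]
      map_smul' := by
        intro c f
        apply Lp.ext
        have h3 := (quasiMeasurePreserving_mul_right' μ (P h)).ae (Lp.coeFn_smul c f)
        filter_upwards [translate_ae μ (P h) (c • f), translate_ae μ (P h) f, h3,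
          Lp.coeFn_smul c (translate μ (P h) f)] with g a b d e
        simp only [RingHom.id_apply]
        rw [a, d, e, Pi.smul_apply, Pi.smul_apply, b] }
  map_one' := by
    ext1 f
    apply Lp.ext
    filter_upwards [translate_ae μ (P 1) f] with g a
    simpa using a
  map_mul' h k := by
    ext1 f
    apply Lp.ext
    have h3 := (quasiMeasurePreserving_mul_right' μ (P h)).ae (translate_ae μ (P k) f)
    filter_upwards [translate_ae μ (P (h * k)) f,
      translate_ae μ (P h) (translate μ (P k) f), h3] with g a b c
    simp only [LinearMap.coe_mk, AddHom.coe_mk, Module.End.mul_apply]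
    rw [a, b, c, map_mul, mul_assoc]

theorem translationAction_ae (P : H →* G) (h : H) (f : LInf μ) :
    translationAction μ P h f =ᵐ[μ] fun g => f (g * P h) :=
  translate_ae μ (P h) f

end Translation

end IntegrableAction

end

/-! Both sides say that `P` is a proper map (`isIntegrableAction_iff_isProperMap`,
`isProperMap_iff_isCompact_ker_and_isHomeomorph`).

If the action is integrable, density at the constant `1` gives an integrable `f` with `Re ⟨f, φ⟩ >
0` for a continuous compactly supported `φ ≥ 0`. The function `J(s) = Re ∫ f(g s) φ(g) dg` is
continuous, positive at `1`, and the positive part of `J ∘ P` has finite Haar integral. By Markov,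
`P ⁻¹' V` has finite measure for some neighbourhood `V` of `1`; a packing argument makes the
preimage of a smaller neighbourhood relatively compact, and translation spreads this over `G`.

If `P` is proper, every continuous compactly supported `c ≥ 0` is integrable: `y(g) = ∫ c(g P(h))
dh` is continuous and bounded, and Tonelli identifies it as the integral of the orbit. Such `c` are
σ-weakly dense in the positive cone. The Haar measures need not be σ-finite, so density and Tonelli
are both reduced to finite inner regular measures `w dμ` with `w` integrable. -/

open Set Filter Topology
open scoped Pointwise

noncomputable section

namespace IntegrableAction
-- Proper homomorphisms
section Proper

theorem isProperMap_of_forall_nhds {X Y : Type*} [TopologicalSpace X] [TopologicalSpace Y]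
    [T2Space Y] [LocallyCompactSpace Y] {f : X → Y} (hf : Continuous f)
    (h : ∀ y, ∃ U ∈ 𝓝 y, ∃ C, IsCompact C ∧ f ⁻¹' U ⊆ C) : IsProperMap f := by
  refine isProperMap_iff_isCompact_preimage.2 ⟨hf, fun K hK => ?_⟩
  obtain ⟨C, hC, hKC⟩ : ∃ C, IsCompact C ∧ f ⁻¹' K ⊆ C := by
    refine hK.induction_on (p := fun S => ∃ C, IsCompact C ∧ f ⁻¹' S ⊆ C)
      ⟨∅, isCompact_empty, by simp⟩ ?_ ?_ ?_
    · rintro s t hst ⟨C, hC, h⟩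
      exact ⟨C, hC, (preimage_mono hst).trans h⟩
    · rintro s t ⟨C, hC, h⟩ ⟨D, hD, h'⟩
      exact ⟨C ∪ D, hC.union hD, by rw [preimage_union]; exact union_subset_union h h'⟩
    · intro y _
      obtain ⟨U, hU, hC⟩ := h y
      exact ⟨U, mem_nhdsWithin_of_mem_nhds hU, hC⟩
  exact hC.of_isClosed_subset (hK.isClosed.preimage hf) hKC

/-- Proper means continuous and closed with compact fibres. Nonempty fibres are cosets of the
kernel, and the quotient by a compact subgroup is a closed map. -/
theorem isProperMap_iff_isCompact_ker_and_isHomeomorph {G H : Type*} [Group G]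
    [TopologicalSpace G] [T2Space G] [Group H] [TopologicalSpace H] [IsTopologicalGroup H]
    {P : H →* G} (hP : Continuous P) :
    IsProperMap P ↔ IsCompact (P.ker : Set H) ∧ IsClosed (Set.range P) ∧
      IsHomeomorph (QuotientGroup.rangeKerLift P) := by
  have hcomp : (P : H → G) = fun h : H =>
      ((QuotientGroup.rangeKerLift P (h : H ⧸ P.ker) : P.range) : G) := rfl
  constructor
  · intro h
    refine ⟨?_, h.isClosedMap.isClosed_range, ?_⟩
    · have := h.isCompact_preimage (isCompact_singleton (x := (1 : G)))
      exact this
    · rw [isHomeomorph_iff_continuous_isClosedMap_bijective]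
      refine ⟨?_, fun C hC => ?_, QuotientGroup.rangeKerLift_injective P,
        QuotientGroup.rangeKerLift_surjective P⟩
      · rw [← QuotientGroup.isOpenQuotientMap_mk.continuous_comp_iff, continuous_induced_rng]
        exact hP
      · have h1 := h.isClosedMap _ (hC.preimage QuotientGroup.continuous_mk)
        have h2 : QuotientGroup.rangeKerLift P '' C =
            Subtype.val ⁻¹' (P '' ((QuotientGroup.mk : H → H ⧸ P.ker) ⁻¹' C)) := by
          ext x
          constructor
          · rintro ⟨q, hq, rfl⟩
            induction q using QuotientGroup.induction_on with
            | H k => exact ⟨k, hq, rfl⟩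
          · rintro ⟨k, hk, hx⟩
            exact ⟨k, hk, Subtype.ext hx⟩
        rw [h2]
        exact h1.preimage continuous_subtype_val
  · rintro ⟨hk, hr, hh⟩
    refine isProperMap_iff_isClosedMap_and_compact_fibers.2 ⟨hP, ?_, fun y => ?_⟩
    · have hr' : IsClosed (P.range : Set G) := by simpa using hr
      rw [hcomp]
      exact hr'.isClosedMap_subtype_val.comp
        (hh.isClosedMap.comp (QuotientGroup.isClosedMap_coe hk))
    · by_cases hy : ∃ h, P h = y
      · obtain ⟨h, rfl⟩ := hy
        convert hk.smul h using 1
        ext k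
        simpa [mem_smul_set_iff_inv_smul_mem, MonoidHom.mem_ker, inv_mul_eq_one] using eq_comm
      · convert isCompact_empty using 1
        exact eq_empty_of_forall_notMem fun k hk => hy ⟨k, hk⟩

variable {G H : Type*} [Group G] [TopologicalSpace G] [IsTopologicalGroup G]
  [Group H] [TopologicalSpace H] [IsTopologicalGroup H]

/-- If `W⁻¹ W ⊆ V`, the preimage of `W` lies in one translate `h • C`, for any `h` with `P h ∈ W`.
-/
theorem isProperMap_of_nhds_one [LocallyCompactSpace G] [T2Space G] {P : H →* G}
    (hP : Continuous P) {V : Set G} (hV : V ∈ 𝓝 1) {C : Set H} (hC : IsCompact C)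
    (hVC : P ⁻¹' V ⊆ C) : IsProperMap P := by
  refine isProperMap_of_forall_nhds hP fun y => ?_
  obtain ⟨W, hW, hWV⟩ : ∃ W ∈ 𝓝 y, ∀ a ∈ W, ∀ b ∈ W, a⁻¹ * b ∈ V := by
    have ht : Tendsto (fun p : G × G => p.1⁻¹ * p.2) (𝓝 y ×ˢ 𝓝 y) (𝓝 1) := by
      rw [← nhds_prod_eq]
      exact Continuous.tendsto' (by fun_prop) _ _ (by simp)
    obtain ⟨W, hW, hWV⟩ := mem_prod_same_iff.1 (ht hV)
    exact ⟨W, hW, fun a ha b hb => hWV (mk_mem_prod ha hb)⟩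
  refine ⟨W, hW, ?_⟩
  by_cases hne : ∃ h, P h ∈ W
  · obtain ⟨h, hh⟩ := hne
    refine ⟨h • C, hC.smul h, fun k hk => ?_⟩
    rw [mem_smul_set_iff_inv_smul_mem]
    exact hVC (by simpa using hWV _ hh _ hk)
  · exact ⟨∅, isCompact_empty, fun k hk => hne ⟨k, hk⟩⟩

/-- A subset `A` of a group such that some neighbourhood of `A` of the form `A C` has finite Haar
measure is relatively compact. -/
theorem exists_isCompact_superset_of_measure_mul_ne_top [T2Space H] [MeasurableSpace H]
    [BorelSpace H] (ν : Measure H) [ν.IsHaarMeasure] {A C : Set H} (hC : IsCompact C)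
    (hC1 : C ∈ 𝓝 1) (hfin : ν (A * C) ≠ ∞) : ∃ D, IsCompact D ∧ A ⊆ D := by
  have hpos : ν C ≠ 0 := (measure_pos_of_mem_nhds ν hC1).ne'
  let Q : Finset H → Prop := fun F =>
    (F : Set H) ⊆ A ∧ (F : Set H).PairwiseDisjoint (fun h => h • C)
  have hcard : ∀ F, Q F → F.card * ν C ≤ ν (A * C) := by
    intro F hF
    calc F.card * ν C = ∑ h ∈ F, ν (h • C) := by simp [measure_smul]
      _ = ν (⋃ h ∈ F, h • C) :=
        (measure_biUnion_finset hF.2 fun h _ => (hC.smul h).measurableSet).symm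
      _ ≤ ν (A * C) := by
        refine measure_mono (iUnion₂_subset fun h hh => ?_)
        rintro _ ⟨c, hc, rfl⟩
        exact mul_mem_mul (hF.1 hh) hc
  obtain ⟨N, hN⟩ := ENNReal.exists_nat_gt (ENNReal.div_ne_top hfin hpos)
  have hbdd : ∀ F, Q F → F.card ≤ N := by
    intro F hF
    have h1 : (F.card : ℝ≥0∞) ≤ ν (A * C) / ν C := by
      rw [ENNReal.le_div_iff_mul_le (Or.inl hpos) (Or.inl hC.measure_ne_top)]
      exact hcard F hF
    exact_mod_cast (h1.trans hN.le)
  -- Disjoint translates of `C` by elements of `A` fit inside `A * C`, so their number is bounded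
  -- and a largest family exists.
  obtain ⟨F, hF, hmax⟩ : ∃ F, Q F ∧ ∀ F', Q F' → F'.card ≤ F.card := by
    have hne : ({n | ∃ F, Q F ∧ F.card = n} : Set ℕ).Nonempty := ⟨0, ∅, by simp [Q], rfl⟩
    have hb : BddAbove ({n | ∃ F, Q F ∧ F.card = n} : Set ℕ) :=
      ⟨N, by rintro _ ⟨F, hF, rfl⟩; exact hbdd F hF⟩
    obtain ⟨F, hF, hc⟩ := Nat.sSup_mem hne hb
    exact ⟨F, hF, fun F' hF' => hc ▸ le_csSup hb ⟨F', hF', rfl⟩⟩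
  -- By maximality, for `a ∈ A` outside `F` the translate `a • C` meets some `b • C` with `b ∈ F`,
  -- whence `a ∈ b C C⁻¹`.
  refine ⟨(F : Set H) * (C * C⁻¹), F.finite_toSet.isCompact.mul (hC.mul hC.inv), fun a ha => ?_⟩
  by_cases haF : a ∈ F
  · exact ⟨a, haF, 1, ⟨1, mem_of_mem_nhds hC1, 1, by simpa using mem_of_mem_nhds hC1, by simp⟩,
      by simp⟩
  by_contra hcon
  classical
  have hQ : Q (insert a F) := by
    refine ⟨by simpa [insert_subset_iff] using ⟨ha, hF.1⟩, ?_⟩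
    rw [Finset.coe_insert]
    refine hF.2.insert fun b hb _ => ?_
    rw [Set.disjoint_left]
    rintro _ ⟨c, hc, rfl⟩ ⟨d, hd, hcd⟩
    refine hcon ⟨b, hb, d * c⁻¹, ⟨d, hd, c⁻¹, by simpa using hc, rfl⟩, ?_⟩
    simp only [smul_eq_mul] at hcd ⊢
    rw [← mul_assoc, hcd, mul_inv_cancel_right]
  have := hmax _ hQ
  rw [Finset.card_insert_of_notMem haF] at this
  omega

theorem isProperMap_of_measure_preimage_ne_top [LocallyCompactSpace G] [T2Space G]
    [LocallyCompactSpace H] [T2Space H] [MeasurableSpace H]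
    [BorelSpace H] (ν : Measure H) [ν.IsHaarMeasure] {P : H →* G} (hP : Continuous P) {V : Set G}
    (hV : V ∈ 𝓝 1) (hfin : ν (P ⁻¹' V) ≠ ∞) : IsProperMap P := by
  obtain ⟨W, hW, hWV⟩ := exists_nhds_one_split hV
  obtain ⟨C, hC, hC1, hCW⟩ : ∃ C : Set H, IsCompact C ∧ C ∈ 𝓝 1 ∧ C ⊆ P ⁻¹' W := by
    have : P ⁻¹' W ∈ 𝓝 (1 : H) := hP.continuousAt.preimage_mem_nhds (by simpa using hW)
    obtain ⟨C, h1, h2, h3⟩ := local_compact_nhds this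
    exact ⟨C, h3, h1, h2⟩
  obtain ⟨D, hD, hWD⟩ := exists_isCompact_superset_of_measure_mul_ne_top ν (A := P ⁻¹' W) hC hC1
    (ne_top_of_le_ne_top hfin (measure_mono (by
      rintro _ ⟨a, ha, c, hc, rfl⟩
      simpa using hWV _ ha _ (hCW hc))))
  exact isProperMap_of_nhds_one hP hW hD hWD

end Proper
-- The duality pairing and σ-weak closures
section Pairing

variable {X : Type*} [MeasurableSpace X] {μ : Measure X}

theorem ae_norm_mul_le (f : LInf μ) (φ : LOne μ) : ∀ᵐ x ∂μ, ‖f x * φ x‖ ≤ ‖f‖ * ‖φ x‖ := by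
  filter_upwards [ae_norm_le_norm_of_top f] with x hx
  rw [norm_mul]
  gcongr

theorem integrable_mul (f : LInf μ) (φ : LOne μ) : Integrable (fun x => f x * φ x) μ :=
  ((L1.integrable_coeFn φ).norm.const_mul ‖f‖).mono'
    ((Lp.aestronglyMeasurable f).mul (Lp.aestronglyMeasurable φ)) (ae_norm_mul_le f φ)

theorem mem_closure_sigmaWeak_iff {S : Set (LInf μ)} {f : LInf μ} :
    f ∈ @closure (LInf μ) (sigmaWeak μ) S ↔ ∀ (I : Finset (LOne μ)) (ε : ℝ), 0 < ε →
      ∃ c ∈ S, ∀ φ ∈ I, ‖pairing c φ - pairing f φ‖ < ε := by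
  rw [sigmaWeak, closure_induced, mem_closure_iff]
  constructor
  · intro h I ε hε
    obtain ⟨_, hx, ⟨c, hc, rfl⟩⟩ := h
      ((I : Set (LOne μ)).pi fun φ => Metric.ball (pairing f φ) ε)
      (isOpen_set_pi I.finite_toSet fun _ _ => Metric.isOpen_ball)
      (fun φ _ => Metric.mem_ball_self hε)
    exact ⟨c, hc, fun φ hφ => by simpa [dist_eq_norm] using hx φ hφ⟩
  · intro h o ho hfo
    obtain ⟨I, u, hu, huo⟩ := isOpen_pi_iff.1 ho _ hfo
    have hev : ∀ᶠ ε in 𝓝[>] (0 : ℝ), ∀ φ ∈ I, Metric.ball (pairing f φ) ε ⊆ u φ := by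
      rw [Finset.eventually_all]
      intro φ hφ
      obtain ⟨δ, hδ, hb⟩ := Metric.isOpen_iff.1 (hu φ hφ).1 _ (hu φ hφ).2
      filter_upwards [Ioo_mem_nhdsGT hδ] with ε hε
      exact (Metric.ball_subset_ball hε.2.le).trans hb
    obtain ⟨ε, hε, hε0⟩ := (hev.and self_mem_nhdsWithin).exists
    obtain ⟨c, hc, hcI⟩ := h I ε hε0
    exact ⟨_, huo fun φ hφ => hε φ hφ (by simpa [dist_eq_norm] using hcI φ hφ), c, hc, rfl⟩

theorem locallyIntegrable_coeFn [TopologicalSpace X] [IsLocallyFiniteMeasure μ] (f : LInf μ) :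
    LocallyIntegrable f μ := by
  refine (locallyIntegrable_const ‖f‖ : LocallyIntegrable (fun _ : X => ‖f‖) μ).mono
    (Lp.aestronglyMeasurable f) ?_
  filter_upwards [ae_norm_le_norm_of_top f] with g hg
  simpa using hg

end Pairing

/-! ### Integrability of the action implies properness -/

section Necessity

variable {G : Type*} [Group G] [TopologicalSpace G] [IsTopologicalGroup G]
  [LocallyCompactSpace G] [MeasurableSpace G] [BorelSpace G]
  (μ : Measure G)

theorem continuous_integral_mul_right_translate {f φ : G → ℂ} (hf : LocallyIntegrable f μ)
    (hφ : Continuous φ) (hφc : HasCompactSupport φ) :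
    Continuous fun s => ∫ g, f g * φ (g * s⁻¹) ∂μ := by
  refine continuous_iff_continuousAt.2 fun s₀ => ?_
  obtain ⟨S, hS, hS₀⟩ := exists_compact_mem_nhds s₀
  have hk : IsCompact (tsupport φ * S) := hφc.isCompact.mul hS
  refine (continuousOn_integral_bilinear_of_locally_integrable_of_compact_support
    (ContinuousLinearMap.mul ℝ ℂ) (f := fun s g => φ (g * s⁻¹)) (g := f) (s := S) hk
    ?_ ?_ (hf.integrableOn_isCompact hk)).continuousAt hS₀
  · exact (hφ.comp (by fun_prop : Continuous fun p : G × G => p.2 * p.1⁻¹)).continuousOn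
  · intro s g hs hg
    by_contra h
    exact hg ⟨g * s⁻¹, subset_tsupport _ h, s, hs, by simp⟩

variable [IsHaarMeasure μ] [InnerRegular μ]

theorem integral_comp_mul_right (F : G → ℂ) (s : G) :
    ∫ g, F (g * s) ∂μ = modularCharacterFun s • ∫ g, F g ∂μ := by
  rw [← integral_smul_nnreal_measure, ← map_right_mul_eq_modularCharacterFun_smul μ s]
  exact ((Homeomorph.mulRight s).measurableEmbedding.integral_map _).symm

/-- The modular function is the quotient of `∫ ψ(g s) dg` by `∫ ψ`, for a fixed bump function `ψ`.
-/
theorem continuous_modularCharacterFun (μ : Measure G) [IsHaarMeasure μ] [InnerRegular μ] :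
    Continuous fun s : G => ((modularCharacterFun s : ℝ) : ℂ) := by
  obtain ⟨ψ, hψc, hψ0, hψ1⟩ := exists_continuous_nonneg_pos (1 : G)
  have hpos : 0 < ∫ g, ψ g ∂μ :=
    ψ.continuous.integral_pos_of_hasCompactSupport_nonneg_nonzero hψc hψ0 hψ1
  have hne : (∫ g, (ψ g : ℂ) ∂μ) ≠ 0 := by
    rw [integral_complex_ofReal]
    exact_mod_cast hpos.ne'
  have hc : Continuous fun s : G => ∫ g, (1 : ℂ) * (ψ (g * s⁻¹) : ℂ) ∂μ :=
    continuous_integral_mul_right_translate μ (f := fun _ => 1) (φ := fun g => (ψ g : ℂ))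
      (locallyIntegrable_const 1) (by fun_prop) (hψc.comp_left Complex.ofReal_zero)
  have hc' := (hc.comp continuous_inv).div_const (∫ g, (ψ g : ℂ) ∂μ)
  convert hc' using 2 with s
  have h := integral_comp_mul_right μ (fun g => (ψ g : ℂ)) s
  simp only [Function.comp_apply, inv_inv, one_mul]
  rw [h, eq_div_iff hne, NNReal.smul_def, Complex.real_smul]

variable {H : Type*} [Group H] (P : H →* G)

theorem slice_translationAction (f : LInf μ) (φ : LOne μ) (h : H) :
    slice (translationAction μ P) f φ h = ∫ g, f (g * P h) * φ g ∂μ := by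
  refine integral_congr_ae ?_
  filter_upwards [translationAction_ae μ P h f] with g hg
  rw [hg]

/-- Substituting `g ↦ g (P h)⁻¹` moves the translation from the merely measurable `f` to the
continuous `ψ`, at the cost of a modular factor. -/
theorem continuous_slice [TopologicalSpace H] (hP : Continuous P) (f : LInf μ) (φ : LOne μ)
    {ψ : G → ℂ} (hψ : Continuous ψ) (hψc : HasCompactSupport ψ) (hφ : φ =ᵐ[μ] ψ) :
    Continuous (slice (translationAction μ P) f φ) := by
  have h1 : slice (translationAction μ P) f φ = fun h => ((modularCharacterFun (P h) : ℝ) : ℂ) *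
      ∫ g, f g * ψ (g * (P h)⁻¹) ∂μ := by
    ext h
    rw [slice_translationAction, ← Complex.real_smul, ← NNReal.smul_def,
      ← integral_comp_mul_right μ (fun g => f g * ψ (g * (P h)⁻¹))]
    refine integral_congr_ae ?_
    filter_upwards [hφ] with g hg
    rw [hg, mul_inv_cancel_right]
  rw [h1]
  exact ((continuous_modularCharacterFun μ).comp hP).mul
    ((continuous_integral_mul_right_translate μ (locallyIntegrable_coeFn f) hψ hψc).comp hP)

theorem isProperMap_of_isIntegrableAction [T2Space G] [TopologicalSpace H] [IsTopologicalGroup H]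
    [LocallyCompactSpace H] [T2Space H] [MeasurableSpace H] [BorelSpace H]
    (ν : Measure H) [ν.IsHaarMeasure] (hP : Continuous P)
    (hint : IsIntegrableAction (translationAction μ P) ν) : IsProperMap P := by
  obtain ⟨ψ, hψc, hψ0, hψ1⟩ := exists_continuous_nonneg_pos (1 : G)
  have hpos : 0 < ∫ g, ψ g ∂μ :=
    ψ.continuous.integral_pos_of_hasCompactSupport_nonneg_nonzero hψc hψ0 hψ1
  have hψC : Continuous fun g => (ψ g : ℂ) := by fun_prop
  have hψCc : HasCompactSupport fun g => (ψ g : ℂ) := hψc.comp_left Complex.ofReal_zero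
  have hmem : MemLp (fun g => (ψ g : ℂ)) 1 μ :=
    memLp_one_iff_integrable.2 (hψC.integrable_of_hasCompactSupport hψCc)
  set φ : LOne μ := hmem.toLp _
  have hφ : φ =ᵐ[μ] fun g => (ψ g : ℂ) := hmem.coeFn_toLp
  have hφpos : φ ∈ posNormal μ := by
    filter_upwards [hφ] with g hg
    rw [hg]
    exact_mod_cast hψ0 g
  have hone : MemLp (fun _ : G => (1 : ℂ)) ∞ μ := memLp_top_const 1
  have hone_ae := hone.coeFn_toLp
  have hone_pos : hone.toLp _ ∈ posCone μ := by
    filter_upwards [hone_ae] with g hg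
    rw [hg]
    exact zero_le_one
  have hpair : pairing (hone.toLp _) φ = ((∫ g, ψ g ∂μ : ℝ) : ℂ) := by
    rw [← integral_complex_ofReal]
    refine integral_congr_ae ?_
    filter_upwards [hφ, hone_ae] with g h1 h2
    rw [h1, h2, one_mul]
  obtain ⟨f, ⟨-, y, -, hy⟩, hf⟩ := mem_closure_sigmaWeak_iff.1 (hint hone_pos) {φ} _ hpos
  have hre : 0 < (pairing f φ).re := by
    have h1 := (Complex.abs_re_le_norm _).trans_lt (hf φ (by simp))
    rw [hpair, Complex.sub_re, Complex.ofReal_re, abs_lt] at h1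
    linarith
  -- Taking the identity homomorphism puts the slice on `G` itself; the slice along `P` is then `J ∘
  -- P`.
  let J : G → ℝ := fun s => (slice (translationAction μ (MonoidHom.id G)) f φ s).re
  have hJ : Continuous J := Complex.continuous_re.comp
    (continuous_slice μ (MonoidHom.id G) continuous_id f φ hψC hψCc hφ)
  have hJP : ∀ h, (slice (translationAction μ P) f φ h).re = J (P h) := fun h => by
    simp only [J, slice_translationAction, MonoidHom.id_apply]
  have hJ1 : 0 < J 1 := by simpa [J, slice] using hre
  refine isProperMap_of_measure_preimage_ne_top ν hP (V := {s | J 1 / 2 ≤ J s})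
    (mem_of_superset ((isOpen_lt continuous_const hJ).mem_nhds (half_lt_self hJ1))
      fun s hs => le_of_lt (mem_ofPred_eq ▸ hs)) ?_
  have hmarkov := mul_meas_ge_le_lintegral (μ := ν)
    (ENNReal.continuous_ofReal.comp (hJ.comp hP)).measurable (ENNReal.ofReal (J 1 / 2))
  have hfin : ∫⁻ h, ENNReal.ofReal (J (P h)) ∂ν ≠ ∞ := by
    have := hy φ hφpos
    simp only [hJP] at this
    rw [this]
    exact ENNReal.ofReal_ne_top
  have hc0 : ENNReal.ofReal (J 1 / 2) ≠ 0 := by simpa using hJ1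
  refine ne_top_of_le_ne_top (ENNReal.div_ne_top hfin hc0) ?_
  rw [ENNReal.le_div_iff_mul_le (Or.inl hc0) (Or.inl ENNReal.ofReal_ne_top), mul_comm]
  refine (mul_le_mul_right (measure_mono fun h hh => ?_) _).trans hmarkov
  exact ENNReal.ofReal_le_ofReal hh

end Necessity
-- σ-weak density of continuous compactly supported functions
section Density

variable {X : Type*} [TopologicalSpace X] [T2Space X] [MeasurableSpace X] [BorelSpace X]

/-- The sets where `w ≥ 1/(n+1)` have finite `μ`-measure and exhaust `{w ≠ 0}`. Inner regularity of
`μ` applies on each, and absolute continuity of the integral makes the discarded part small for `w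
dμ`. -/
theorem innerRegularCompactLTTop_withDensity (μ : Measure X) [InnerRegularCompactLTTop μ]
    {w : X → ℝ≥0∞} (hw : Measurable w) (hfin : ∫⁻ x, w x ∂μ ≠ ∞) :
    InnerRegularCompactLTTop (μ.withDensity w) := by
  refine ⟨?_⟩
  rintro E ⟨hE, -⟩ r hr
  have hmono : Monotone fun n : ℕ => E ∩ {x | ((n : ℝ≥0∞) + 1)⁻¹ ≤ w x} := fun m n hmn x hx =>
    ⟨hx.1, le_trans (b := ((m : ℝ≥0∞) + 1)⁻¹) (by gcongr) hx.2⟩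
  have hU : E ∩ {x | w x ≠ 0} = ⋃ n : ℕ, E ∩ {x | ((n : ℝ≥0∞) + 1)⁻¹ ≤ w x} := by
    rw [← inter_iUnion]
    congr 1
    ext x
    simp only [mem_ofPred_eq, mem_iUnion]
    constructor
    · intro hx
      obtain ⟨n, hn⟩ := ENNReal.exists_inv_nat_lt hx
      exact ⟨n, le_trans (by simp) hn.le⟩
    · rintro ⟨n, hn⟩ h0
      rw [h0] at hn
      simp at hn
  have hE' : μ.withDensity w E = ⨆ n : ℕ, μ.withDensity w (E ∩ {x | ((n : ℝ≥0∞) + 1)⁻¹ ≤ w x}) := by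
    rw [← hmono.measure_iUnion, ← hU]
    refine (measure_inter_add_sdiff E (hw (measurableSet_singleton 0)).compl).symm.trans ?_
    have h0 : μ.withDensity w (E \ (w ⁻¹' {0})ᶜ) = 0 := by
      rw [withDensity_apply _ (hE.diff (hw (measurableSet_singleton 0)).compl)]
      refine (setLIntegral_congr_fun (g := fun _ => 0)
        (hE.diff (hw (measurableSet_singleton 0)).compl) fun x hx => ?_).trans (by simp)
      simpa using hx.2
    rw [h0, add_zero]
    rfl
  rw [hE'] at hr
  obtain ⟨n, hn⟩ := lt_iSup_iff.1 hr
  set A := E ∩ {x | ((n : ℝ≥0∞) + 1)⁻¹ ≤ w x}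
  have hA : MeasurableSet A := hE.inter (measurableSet_le measurable_const hw)
  have hμA : μ A ≠ ∞ := by
    refine ne_top_of_le_ne_top ?_ (measure_mono inter_subset_right)
    exact ne_top_of_le_ne_top (ENNReal.div_ne_top hfin (by simp))
      (meas_ge_le_lintegral_div hw.aemeasurable (by simp) (by simp))
  obtain ⟨δ, hδ, hδA⟩ := exists_pos_setLIntegral_lt_of_measure_lt hfin (tsub_pos_of_lt hn).ne'
  obtain ⟨K, hKA, hK, hμK⟩ := hA.exists_isCompact_sdiff_lt hμA hδ.ne'
  refine ⟨K, hKA.trans inter_subset_left, hK, ?_⟩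
  have h1 := hδA _ hμK
  rw [← withDensity_apply _ (hA.diff hK.measurableSet)] at h1
  have h2 : μ.withDensity w A ≤ μ.withDensity w K + μ.withDensity w (A \ K) := by
    rw [← measure_inter_add_sdiff A hK.measurableSet]
    gcongr
    exact inter_subset_right
  by_contra! hle
  exact (h2.trans_lt (ENNReal.add_lt_add_of_le_of_lt (ne_top_of_le_ne_top hn.ne_top hle) hle h1)).ne
    (add_tsub_cancel_of_le hn.le).symm

theorem exists_hasCompactSupport_eLpNorm_one_sub_le [LocallyCompactSpace X] {m : Measure X}
    [IsFiniteMeasure m] [InnerRegularCompactLTTop m] {f : X → ℝ} (hf : MemLp f 1 m) {ε : ℝ≥0∞}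
    (hε : ε ≠ 0) :
    ∃ g : X → ℝ, eLpNorm (f - g) 1 m ≤ ε ∧ Continuous g ∧ HasCompactSupport g := by
  refine hf.induction_dense ENNReal.one_ne_top (fun g => Continuous g ∧ HasCompactSupport g)
    ?_ ?_ ?_ hε
  · intro c t ht _ ε hε
    -- For `c = 0` this quotient is `∞`, so no case split is needed.
    have hε' : ε / 2 / ‖c‖ₑ ≠ 0 := ENNReal.div_ne_zero.2 ⟨by simpa using hε, by finiteness⟩
    obtain ⟨K, hKt, hK, hmK⟩ := ht.exists_isCompact_sdiff_lt (measure_ne_top m t) hε'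
    obtain ⟨U, htU, hU, -, hmU⟩ := ht.exists_isOpen_sdiff_lt (measure_ne_top m t) hε'
    obtain ⟨u, hu1, hu0, huc, hu⟩ := exists_continuous_one_zero_of_isCompact hK hU.isClosed_compl
      (disjoint_compl_right_iff_subset.2 (hKt.trans htU))
    refine ⟨fun x => u x * c, ?_, by fun_prop, huc.mul_right⟩
    have hle : ∀ x, ‖((fun x => u x * c) - t.indicator fun _ => c) x‖ₑ ≤
        (U \ t ∪ t \ K).indicator (fun _ => ‖c‖ₑ) x := by
      intro x
      simp only [Pi.sub_apply]
      by_cases hxK : x ∈ K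
      · simp [hu1 hxK, hKt hxK]
      by_cases hxU : x ∈ U
      · have hx : x ∈ U \ t ∪ t \ K := by
          by_cases hxt : x ∈ t
          · exact Or.inr ⟨hxt, hxK⟩
          · exact Or.inl ⟨hxU, hxt⟩
        rw [indicator_of_mem hx, enorm_le_iff_norm_le]
        have hux := hu x
        by_cases hxt : x ∈ t
        · rw [indicator_of_mem hxt, ← sub_one_mul, norm_mul]
          refine mul_le_of_le_one_left (norm_nonneg c) ?_
          rw [Real.norm_eq_abs, abs_le]
          constructor <;> linarith [hux.1, hux.2]
        · rw [indicator_of_notMem hxt, sub_zero, norm_mul]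
          refine mul_le_of_le_one_left (norm_nonneg c) ?_
          rw [Real.norm_eq_abs, abs_of_nonneg hux.1]
          exact hux.2
      · have hxt : x ∉ t := fun h => hxU (htU h)
        simp [hu0 hxU, hxt]
    rw [eLpNorm_one_eq_lintegral_enorm]
    refine (lintegral_mono hle).trans ((lintegral_indicator_const_le _ _).trans ?_)
    calc ‖c‖ₑ * m (U \ t ∪ t \ K) ≤ ‖c‖ₑ * (ε / 2 / ‖c‖ₑ + ε / 2 / ‖c‖ₑ) := by
          gcongr
          exact (measure_union_le _ _).trans (add_le_add hmU.le hmK.le)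
      _ ≤ ε / 2 + ε / 2 := by
          rw [mul_add]
          exact add_le_add ENNReal.mul_div_le ENNReal.mul_div_le
      _ = ε := ENNReal.add_halves ε
  · rintro f g ⟨hf, hfc⟩ ⟨hg, hgc⟩
    exact ⟨hf.add hg, hfc.add hgc⟩
  · rintro f ⟨hf, -⟩
    exact hf.aestronglyMeasurable

theorem posCone_subset_closure_of_continuous_mem [LocallyCompactSpace X] {μ : Measure X}
    [InnerRegularCompactLTTop μ] [IsFiniteMeasureOnCompacts μ] {S : Set (LInf μ)}
    (hS : ∀ c : X → ℝ, Continuous c → HasCompactSupport c → 0 ≤ c →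
      ∀ f : LInf μ, (f =ᵐ[μ] fun x => (c x : ℂ)) → f ∈ S) :
    posCone μ ⊆ @closure (LInf μ) (sigmaWeak μ) S := by
  intro f hf
  rw [mem_closure_sigmaWeak_iff]
  intro I ε hε
  -- One `L^1` approximation for `w dμ` controls the pairings with all `φ ∈ I` at once.
  let w : X → ℝ≥0∞ := fun x => ∑ φ ∈ I, ‖φ x‖ₑ
  have hw : Measurable w :=
    Finset.measurable_fun_sum _ fun φ _ => (Lp.stronglyMeasurable φ).measurable.enorm
  have hwfin : ∫⁻ x, w x ∂μ ≠ ∞ := by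
    rw [lintegral_finsetSum _ fun φ _ => (Lp.stronglyMeasurable φ).measurable.enorm]
    exact (ENNReal.sum_lt_top.2 fun φ _ => (L1.integrable_coeFn φ).2).ne
  have hfinite : IsFiniteMeasure (μ.withDensity w) := isFiniteMeasure_withDensity hwfin
  have hreg := innerRegularCompactLTTop_withDensity μ hw hwfin
  have hac : μ.withDensity w ≪ μ := withDensity_absolutelyContinuous μ w
  have hre : MemLp (fun x => (f x).re) 1 (μ.withDensity w) := by
    have h1 : AEStronglyMeasurable (fun x => (f x).re) (μ.withDensity w) :=
      (Complex.measurable_re.comp (Lp.stronglyMeasurable f).measurable).aestronglyMeasurable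
    refine MemLp.of_bound h1 ‖f‖ ?_
    filter_upwards [hac.ae_le (ae_norm_le_norm_of_top f)] with x hx
    exact (Complex.abs_re_le_norm _).trans hx
  obtain ⟨c₀, hc₀, hc₀cont, hc₀c⟩ := exists_hasCompactSupport_eLpNorm_one_sub_le hre
    (ε := ENNReal.ofReal (ε / 2)) (by simpa using hε)
  -- Truncation at `0` is 1-Lipschitz and fixes `Re f ≥ 0`, so the error does not grow.
  let c : X → ℝ := fun x => max (c₀ x) 0
  have hc : Continuous c := hc₀cont.max continuous_const
  have hcc : HasCompactSupport c := hc₀c.comp_left (g := fun t => max t 0) (by simp)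
  have hcC : Continuous fun x => (c x : ℂ) := by fun_prop
  have hmem : MemLp (fun x => (c x : ℂ)) ∞ μ :=
    hcC.memLp_top_of_hasCompactSupport (hcc.comp_left Complex.ofReal_zero) μ
  have hce := hmem.coeFn_toLp
  refine ⟨hmem.toLp _, hS c hc hcc (fun x => le_max_right _ _) _ hce, fun φ hφ => ?_⟩
  rw [pairing, pairing, ← integral_sub (integrable_mul _ _) (integrable_mul _ _)]
  have hle : ‖∫ x, (hmem.toLp _ x * φ x - f x * φ x) ∂μ‖ₑ ≤ ENNReal.ofReal (ε / 2) := by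
    refine (enorm_integral_le_lintegral_enorm _).trans (le_trans ?_ hc₀)
    rw [eLpNorm_one_eq_lintegral_enorm]
    simp only [Pi.sub_apply]
    rw [lintegral_withDensity_eq_lintegral_mul _ (h_mf := hw)
      (g := fun x => ‖(f x).re - c₀ x‖ₑ)
      ((Complex.measurable_re.comp (Lp.stronglyMeasurable f).measurable).sub
        hc₀cont.measurable).enorm]
    refine lintegral_mono_ae ?_
    filter_upwards [hce, hf] with x hx hfx
    rw [hx, ← sub_mul, enorm_mul, Pi.mul_apply, mul_comm]
    refine mul_le_mul' (Finset.single_le_sum (f := fun φ : LOne μ => ‖φ x‖ₑ)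
      (fun _ _ => zero_le) hφ) ?_
    have hfre : f x = ((f x).re : ℂ) := Complex.eq_re_of_ofReal_le hfx
    have hf0 : 0 ≤ (f x).re := (Complex.le_def.1 hfx).1
    rw [hfre, ← Complex.ofReal_sub, enorm_le_iff_norm_le, Complex.norm_real,
      Complex.ofReal_re, Real.norm_eq_abs, Real.norm_eq_abs, abs_sub_comm (f x).re]
    have h1 : max (f x).re 0 = (f x).re := max_eq_left hf0
    calc |c x - (f x).re| = |max (c₀ x) 0 - max (f x).re 0| := by rw [h1]
      _ ≤ |c₀ x - (f x).re| := abs_max_sub_max_le_abs _ _ _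
  rw [← ENNReal.ofReal_lt_ofReal_iff hε, ofReal_norm]
  exact hle.trans_lt ((ENNReal.ofReal_lt_ofReal_iff hε).2 (half_lt_self hε))

end Density

/-! ### Tonelli without σ-finiteness -/

section Tonelli

variable {X Y : Type*} [TopologicalSpace X] [T2Space X] [LocallyCompactSpace X]
  [MeasurableSpace X] [BorelSpace X] [TopologicalSpace Y] [T2Space Y] [MeasurableSpace Y]
  [BorelSpace Y]

/-- A continuous function need not be measurable for the product σ-algebra, but a compactly
supported one is; a cutoff in `x` achieves this. -/
theorem exists_measurable_eq_on_compact_prod {F : X × Y → ℝ} (hF : Continuous F)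
    (hsupp : ∀ K : Set X, IsCompact K → ∃ L : Set Y, IsCompact L ∧ ∀ x ∈ K, ∀ y ∉ L, F (x, y) = 0)
    {K : Set X} (hK : IsCompact K) :
    ∃ F' : X × Y → ℝ, Measurable F' ∧ ∀ x ∈ K, ∀ y, F' (x, y) = F (x, y) := by
  obtain ⟨u, hu1, -, huc, -⟩ := exists_continuous_one_zero_of_isCompact hK isClosed_empty
    (disjoint_empty K)
  obtain ⟨L, hL, hLF⟩ := hsupp _ huc
  refine ⟨fun p => u p.1 * F p, ?_, fun x hx y => by simp [hu1 hx]⟩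
  refine HasCompactSupport.measurable_of_prod (by fun_prop)
    (HasCompactSupport.intro (huc.isCompact.prod hL) fun p hp => ?_)
  by_cases h1 : p.1 ∈ tsupport u
  · have h2 : p.2 ∉ L := fun h2 => hp ⟨h1, h2⟩
    rw [hLF p.1 h1 p.2 h2, mul_zero]
  · rw [image_eq_zero_of_notMem_tsupport h1, zero_mul]

/-- The finite measure `m` lives on an increasing sequence of compact sets. Over each, `F` is
supported in a compact product, where Tonelli holds; monotone convergence concludes. -/
theorem lintegral_lintegral_swap_of_proper_support (m : Measure X) [IsFiniteMeasure m]
    [InnerRegularCompactLTTop m] (ν : Measure Y) [IsFiniteMeasureOnCompacts ν]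
    {F : X × Y → ℝ} (hF : Continuous F)
    (hsupp : ∀ K : Set X, IsCompact K → ∃ L : Set Y, IsCompact L ∧
      ∀ x ∈ K, ∀ y ∉ L, F (x, y) = 0) :
    ∫⁻ y, ∫⁻ x, ENNReal.ofReal (F (x, y)) ∂m ∂ν = ∫⁻ x, ∫⁻ y, ENNReal.ofReal (F (x, y)) ∂ν ∂m := by
  have hex : ∀ n : ℕ, ∃ K : Set X, IsCompact K ∧ m Kᶜ < ((n : ℝ≥0∞) + 1)⁻¹ := fun n => by
    obtain ⟨K, -, hK, h⟩ := MeasurableSet.univ.exists_isCompact_sdiff_lt (μ := m)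
      (measure_ne_top m _) (ε := ((n : ℝ≥0∞) + 1)⁻¹) (by simp)
    exact ⟨K, hK, by rwa [compl_eq_univ_sdiff]⟩
  choose K₀ hK₀ hmK₀ using hex
  let K : ℕ → Set X := fun n => partialSups K₀ n
  have hKmono : Monotone K := (partialSups K₀).monotone
  have hK : ∀ n, IsCompact (K n) := by
    intro n
    simp only [K, partialSups_eq_biUnion_range]
    exact (Finset.finite_toSet _).isCompact_biUnion fun i _ => hK₀ i
  have hKU : m (⋃ n, K n)ᶜ = 0 := by
    refine le_antisymm (ENNReal.le_of_forall_pos_le_add fun δ hδ _ => ?_) zero_le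
    obtain ⟨n, hn⟩ := ENNReal.exists_inv_nat_lt (ENNReal.coe_ne_zero.2 hδ.ne')
    rw [zero_add]
    refine le_trans (measure_mono (compl_subset_compl.2 ?_)) ((hmK₀ n).le.trans (le_trans ?_ hn.le))
    · exact (le_partialSups K₀ n).trans (subset_iUnion K n)
    · simp
  have hres : ∀ g : X → ℝ≥0∞, ∫⁻ x, g x ∂m = ⨆ n, ∫⁻ x in K n, g x ∂m := by
    intro g
    rw [← setLIntegral_iUnion_of_directed _ hKmono.directed_le, restrict_eq_self_of_ae_mem]
    exact hKU
  have hmeas : ∀ n, Measurable fun y => ∫⁻ x in K n, ENNReal.ofReal (F (x, y)) ∂m := by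
    intro n
    obtain ⟨F', hF', hFF'⟩ := exists_measurable_eq_on_compact_prod hF hsupp (hK n)
    have : (fun y => ∫⁻ x in K n, ENNReal.ofReal (F (x, y)) ∂m) =
        fun y => ∫⁻ x in K n, ENNReal.ofReal (F' (x, y)) ∂m := by
      ext y
      exact setLIntegral_congr_fun (hK n).measurableSet fun x hx => by simp [hFF' x hx y]
    rw [this]
    exact (ENNReal.measurable_ofReal.comp hF').lintegral_prod_left'
  rw [hres]
  simp only [hres fun x => ENNReal.ofReal (F (x, _))]
  rw [lintegral_iSup hmeas fun i j hij y => lintegral_mono_set (hKmono hij)]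
  congr 1 with n
  obtain ⟨F', hF', hFF'⟩ := exists_measurable_eq_on_compact_prod hF hsupp (hK n)
  obtain ⟨L, hL, hLF⟩ := hsupp _ (hK n)
  have hfinL : IsFiniteMeasure (ν.restrict L) := ⟨by simpa using hL.measure_lt_top⟩
  calc ∫⁻ y, ∫⁻ x in K n, ENNReal.ofReal (F (x, y)) ∂m ∂ν
      = ∫⁻ y in L, ∫⁻ x in K n, ENNReal.ofReal (F (x, y)) ∂m ∂ν := by
        refine (setLIntegral_eq_of_support_subset fun y hy => ?_).symm
        by_contra hyL
        refine hy ((setLIntegral_congr_fun (g := fun _ => 0) (hK n).measurableSet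
          fun x hx => ?_).trans (by simp))
        simp [hLF x hx y hyL]
    _ = ∫⁻ y in L, ∫⁻ x in K n, ENNReal.ofReal (F' (x, y)) ∂m ∂ν := by
        refine lintegral_congr fun y => ?_
        exact setLIntegral_congr_fun (hK n).measurableSet fun x hx => by simp [hFF' x hx y]
    _ = ∫⁻ x in K n, ∫⁻ y in L, ENNReal.ofReal (F' (x, y)) ∂ν ∂m :=
        lintegral_lintegral_swap
          ((ENNReal.measurable_ofReal.comp hF').comp measurable_swap).aemeasurable
    _ = ∫⁻ x in K n, ∫⁻ y, ENNReal.ofReal (F (x, y)) ∂ν ∂m := by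
        refine setLIntegral_congr_fun (hK n).measurableSet fun x hx => ?_
        simp only [hFF' x hx]
        refine setLIntegral_eq_of_support_subset fun y hy => ?_
        by_contra hyL
        exact hy (by simp [hLF x hx y hyL])

end Tonelli
-- Properness implies integrability of the action
section Sufficiency

theorem comp_mul_map_eq_zero {G H : Type*} [Group G] [TopologicalSpace G] [Group H] {P : H →* G}
    {c : G → ℝ} {K : Set G} {g : G} (hg : g ∈ K) {h : H}
    (hh : h ∉ P ⁻¹' (K⁻¹ * tsupport c)) : c (g * P h) = 0 := by
  by_contra hne
  exact hh ⟨g⁻¹, by simpa using hg, g * P h, subset_tsupport _ hne, by simp⟩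

variable {G H : Type*} [Group G] [TopologicalSpace G] [IsTopologicalGroup G]
  [Group H] [TopologicalSpace H] [MeasurableSpace H] [BorelSpace H] {P : H →* G}

theorem continuous_orbit_integral [LocallyCompactSpace G] (ν : Measure H)
    [IsFiniteMeasureOnCompacts ν] (hP : IsProperMap P) {c : G → ℝ} (hc : Continuous c)
    (hcc : HasCompactSupport c) :
    Continuous fun g => ∫ h, c (g * P h) ∂ν := by
  refine continuous_iff_continuousAt.2 fun g₀ => ?_
  obtain ⟨K, hK, hK₀⟩ := exists_compact_mem_nhds g₀
  have hPc := hP.continuous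
  exact (continuousOn_integral_of_compact_support (f := fun g h => c (g * P h)) (s := K)
    (hP.isCompact_preimage (hK.inv.mul hcc.isCompact))
    (hc.comp (by fun_prop : Continuous fun p : G × H => p.1 * P p.2)).continuousOn
    fun g h hg hh => comp_mul_map_eq_zero hg hh).continuousAt hK₀

theorem exists_norm_orbit_integral_le [IsTopologicalGroup H] (ν : Measure H)
    [ν.IsHaarMeasure] (hP : IsProperMap P) {c : G → ℝ} (hc : Continuous c)
    (hcc : HasCompactSupport c) :
    ∃ B, ∀ g, ‖∫ h, c (g * P h) ∂ν‖ ≤ B := by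
  obtain ⟨M, hM⟩ := hcc.exists_bound_of_continuous hc
  have hM0 : 0 ≤ M := (norm_nonneg _).trans (hM 1)
  set L : Set H := P ⁻¹' ((tsupport c)⁻¹ * tsupport c)
  have hL : IsCompact L := hP.isCompact_preimage (hcc.isCompact.inv.mul hcc.isCompact)
  refine ⟨M * ν.real L, fun g => ?_⟩
  by_cases hne : ∃ h₀, c (g * P h₀) ≠ 0
  -- Left invariance replaces `g` by `g P(h₀)` in the support of `c`, so that the integrand lives on
  -- `L`, independently of `g`.
  · obtain ⟨h₀, hh₀⟩ := hne
    have h1 : ∫ h, c (g * P h) ∂ν = ∫ h, c (g * P h₀ * P h) ∂ν := by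
      rw [← integral_mul_left_eq_self (fun h => c (g * P h)) h₀]
      simp only [map_mul, mul_assoc]
    rw [h1, ← setIntegral_eq_integral_of_forall_compl_eq_zero (s := L)
      fun h hh => comp_mul_map_eq_zero (subset_tsupport _ hh₀) hh]
    exact norm_setIntegral_le_of_norm_le_const hL.measure_lt_top fun h _ => hM _
  · push Not at hne
    simp only [hne, integral_zero, norm_zero]
    positivity

/-- Rewrites pairings as integrals against the finite measure `φ dμ`, the form to which Tonelli
applies. -/
theorem ofReal_re_pairing {X : Type*} [MeasurableSpace X] {μ : Measure X} {f : LInf μ}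
    {φ : LOne μ} (hφ : φ ∈ posNormal μ) {c : X → ℝ} (hc : 0 ≤ c)
    (hcm : AEMeasurable c μ) (hf : f =ᵐ[μ] fun x => (c x : ℂ)) :
    ENNReal.ofReal (pairing f φ).re =
      ∫⁻ x, ENNReal.ofReal (c x) ∂(μ.withDensity fun x => ENNReal.ofReal (φ x).re) := by
  have hφm : Measurable fun x => ENNReal.ofReal (φ x).re :=
    (Complex.measurable_re.comp (Lp.stronglyMeasurable φ).measurable).ennreal_ofReal
  have hmul : ∀ᵐ x ∂μ, (f x * φ x).re = c x * (φ x).re := by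
    filter_upwards [hf] with x hx
    rw [hx, Complex.re_ofReal_mul]
  rw [lintegral_withDensity_eq_lintegral_mul₀ hφm.aemeasurable hcm.ennreal_ofReal, pairing]
  have hint : Integrable (fun x => (f x * φ x).re) μ := (integrable_mul f φ).re
  have hre : (∫ x, f x * φ x ∂μ).re = ∫ x, (f x * φ x).re ∂μ :=
    (integral_re (integrable_mul f φ)).symm
  rw [hre, ofReal_integral_eq_lintegral_ofReal hint]
  · refine lintegral_congr_ae ?_
    filter_upwards [hmul] with x hx
    rw [hx, ENNReal.ofReal_mul (hc x), Pi.mul_apply, mul_comm]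
  · filter_upwards [hmul, hφ] with x hx hφx
    exact hx.symm ▸ mul_nonneg (hc x) (Complex.le_def.1 hφx).1

variable [LocallyCompactSpace G] [T2Space G] [MeasurableSpace G] [BorelSpace G]
  [IsTopologicalGroup H] [T2Space H]

theorem isIntegrableElement_of_continuous (μ : Measure G) [μ.IsHaarMeasure] [μ.InnerRegular]
    (ν : Measure H) [ν.IsHaarMeasure] (hP : IsProperMap P) {c : G → ℝ} (hc : Continuous c)
    (hcc : HasCompactSupport c) (hc0 : 0 ≤ c) {f : LInf μ} (hf : f =ᵐ[μ] fun g => (c g : ℂ)) :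
    IsIntegrableElement (translationAction μ P) ν f := by
  have hPc := hP.continuous
  have hy0 := continuous_orbit_integral ν hP hc hcc
  obtain ⟨B, hB⟩ := exists_norm_orbit_integral_le ν hP hc hcc
  have hmem : MemLp (fun g => ((∫ h, c (g * P h) ∂ν : ℝ) : ℂ)) ∞ μ :=
    memLp_top_of_bound (by fun_prop : Continuous fun g =>
      ((∫ h, c (g * P h) ∂ν : ℝ) : ℂ)).aestronglyMeasurable B
      (Eventually.of_forall fun g => by rw [Complex.norm_real]; exact hB g)
  have hy := hmem.coeFn_toLp
  have hypos : (0 : G → ℝ) ≤ fun g => ∫ h, c (g * P h) ∂ν :=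
    fun g => integral_nonneg fun h => hc0 _
  refine ⟨?_, hmem.toLp _, ?_, fun φ hφ => ?_⟩
  · filter_upwards [hf] with g hg
    rw [hg]
    exact_mod_cast hc0 g
  · filter_upwards [hy] with g hg
    rw [hg]
    exact_mod_cast hypos g
  have hφm : Measurable fun x => ENNReal.ofReal (φ x).re :=
    (Complex.measurable_re.comp (Lp.stronglyMeasurable φ).measurable).ennreal_ofReal
  have hφfin : ∫⁻ x, ENNReal.ofReal (φ x).re ∂μ ≠ ∞ :=
    (L1.integrable_coeFn φ).re.lintegral_lt_top.ne
  have := isFiniteMeasure_withDensity hφfin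
  have := innerRegularCompactLTTop_withDensity μ hφm hφfin
  rw [ofReal_re_pairing hφ hypos hy0.measurable.aemeasurable hy]
  have hslice : ∀ h, ENNReal.ofReal (slice (translationAction μ P) f φ h).re =
      ∫⁻ g, ENNReal.ofReal (c (g * P h)) ∂(μ.withDensity fun x => ENNReal.ofReal (φ x).re) := by
    intro h
    refine ofReal_re_pairing hφ (c := fun g => c (g * P h)) (fun g => hc0 (g * P h))
      (by fun_prop : Continuous fun g => c (g * P h)).measurable.aemeasurable ?_
    filter_upwards [translationAction_ae μ P h f,
      (quasiMeasurePreserving_mul_right' μ (P h)).ae hf] with g h1 h2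
    rw [h1, h2]
  simp only [hslice]
  rw [lintegral_lintegral_swap_of_proper_support _ ν (F := fun p : G × H => c (p.1 * P p.2))
    (by fun_prop) fun K hK => ⟨_, hP.isCompact_preimage (hK.inv.mul hcc.isCompact),
      fun g hg h hh => comp_mul_map_eq_zero hg hh⟩]
  refine lintegral_congr fun g => ?_
  have hint : Integrable (fun h => c (g * P h)) ν :=
    Continuous.integrable_of_hasCompactSupport (by fun_prop) (HasCompactSupport.intro
      (hP.isCompact_preimage (isCompact_singleton.inv.mul hcc.isCompact))
      fun h hh => comp_mul_map_eq_zero (mem_singleton g) hh)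
  exact (ofReal_integral_eq_lintegral_ofReal hint
    (Eventually.of_forall fun h => hc0 (g * P h))).symm

theorem isIntegrableAction_iff_isProperMap [LocallyCompactSpace H] (μ : Measure G)
    [μ.IsHaarMeasure] [μ.InnerRegular] (ν : Measure H) [ν.IsHaarMeasure] (hP : Continuous P) :
    IsIntegrableAction (translationAction μ P) ν ↔ IsProperMap P :=
  ⟨isProperMap_of_isIntegrableAction μ P ν hP, fun h =>
    posCone_subset_closure_of_continuous_mem fun _ hc hcc hc0 _ hf =>
      isIntegrableElement_of_continuous μ ν h hc hcc hc0 hf⟩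

end Sufficiency
end IntegrableAction

end

theorem theorem7p1
    {G H : Type*}
    [Group G] [TopologicalSpace G] [IsTopologicalGroup G] [LocallyCompactSpace G] [T2Space G]
    [MeasurableSpace G] [BorelSpace G]
    [Group H] [TopologicalSpace H] [IsTopologicalGroup H] [LocallyCompactSpace H] [T2Space H]
    [MeasurableSpace H] [BorelSpace H]
    (μ : MeasureTheory.Measure G) [μ.IsHaarMeasure] [μ.InnerRegular]
    (ν : MeasureTheory.Measure H) [ν.IsHaarMeasure] [ν.InnerRegular]
    (P : H →* G) (hP : Continuous P) :
    IntegrableAction.IsIntegrableAction (IntegrableAction.translationAction μ P) ν ↔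
      IsCompact (P.ker : Set H) ∧ IsClosed (Set.range P) ∧
        IsHomeomorph (QuotientGroup.rangeKerLift P) := by
  exact (IntegrableAction.isIntegrableAction_iff_isProperMap μ ν hP).trans
    (IntegrableAction.isProperMap_iff_isCompact_ker_and_isHomeomorph hP)
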